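/- Let $r$ and $d$ be non-negative integers, and let $S_{r,d} = F_r/F_r^{(d)}$ be the free solvable group of rank $r$ and class $d$, where $F_r$ is the free group of rank $r$ and $F_r^{(d)}$ is the $d$-th term of its derived series ($F_r^{(0)} = F_r$). A subgroup $H$ of a group $G$ is called verbally closed in $G$ if, for every group word $w(x_1,\dots,x_n)$ without constants and every $h \in H$, the equation $w(x_1,\dots,x_n) = h$ has a solution in $H$ whenever it has a solution in $G$; and $H$ is called a retract of $G$ if there is a homomorphism $\rho : G \to H$ with $\rho(h) = h$ for all $h \in H$. **Theorem.** Let $H$ be a finitely generated verbally closed subgroup of $G = S_{r,d}$. If $r_{ab}(H) = 1$, where $r_{ab}(H)$ denotes the minimal number of generators of the image $HG'/G'$ of $H$ in the abelianization $G/G'$, then $H$ is a retract of $G$. -/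

import Mathlib

/-- The free solvable group `S_{r,d}` of rank `r` and class `d`, the relatively free group of rank
`r` in the variety of solvable groups of derived length at most `d`: the quotient of the
free group on `r` letters by the `d`-th term of its derived series (where `G⁽⁰⁾ = G`). -/
abbrev FreeSolvableGroup (r d : ℕ) : Type :=
  FreeGroup (Fin r) ⧸ derivedSeries (FreeGroup (Fin r)) d

/-- `H` is verbally closed in `G`: every equation `w(x₁, …, xₙ) = h`, with `w` a group word without
constants and `h ∈ H`, that has a solution in `G` has a solution in `H`. -/
def IsVerballyClosed {G : Type*} [Group G] (H : Subgroup G) : Prop :=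
  ∀ (n : ℕ) (w : FreeGroup (Fin n)) (h : G), h ∈ H →
    (∃ g : Fin n → G, FreeGroup.lift g w = h) →
      ∃ g : Fin n → G, (∀ i, g i ∈ H) ∧ FreeGroup.lift g w = h

/-- `H` is a retract of `G`: there is a homomorphism `G → H` that is the identity on `H`. -/
def IsRetractOf {G : Type*} [Group G] (H : Subgroup G) : Prop :=
  ∃ ρ : G →* H, ∀ h : H, ρ (h : G) = h

/-- `r_ab(H)`: the minimal number of generators of `HG'/G'`, the image of the finitely generated
subgroup `H` in the abelianization of `G`. -/
noncomputable def abRank {G : Type*} [Group G] (H : Subgroup G) [hH : Group.FG H] : ℕ :=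
  haveI : Group.FG (H.map (Abelianization.of (G := G))) :=
    Group.fg_of_surjective (Abelianization.of.subgroupMap_surjective H)
  Group.rank (H.map (Abelianization.of (G := G)))

/-!
The equation used throughout is the one given by an element `w` of the free group itself: if `w`
represents an element of the verbally closed subgroup `H`, then its tautological solution in
`FreeSolvableGroup r d` yields a homomorphism `φ` from the free group to `H` with `φ w = w`
(`IsVerballyClosed.exists_hom`). For `w` in the commutator subgroup this gives `H ∩ G' = H'`. Since
`HG'/G'` is generated by the class of a single `h ∈ H`, every element of `H` is a power of `h` times
an element of `H'`.

It follows that `H'` is trivial. Suppose that the preimage `K` of `H` in the free group `F` satisfies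
`K' ≤ N` for a term `N` of the derived series with `[N, N]` still containing the relations of `G`.
Assigning to a word the 1-chain of its path in the Cayley graph of `F/N` (equivalently, its Fox
derivatives) embeds `N/[N, N]` into the integral 1-chains, equivariantly for conjugation; this is the
Magnus embedding (`mem_commutator_of_pathChain_eq_zero`). The image `M` of `K'` satisfies
`M ≤ (h - 1) M`, because modulo `[N, N]` the group `K` is generated by `h` and its own commutators.
As `h` has infinite order modulo `N`, the chains are sums of copies of the module of finitely
supported functions on `ℤ`, in which `h` acts as the shift and no nonzero subgroup has that property
(`eq_zero_of_forall_eq_shift_sub`). So `M = 0`, that is, `K' ≤ [N, N]`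
(`commutator_le_commutator_of_zpow_generated`), and one descends through the derived series.

Hence `H` is generated by `h`, and a homomorphism `φ : F → H` with `φ h = h` factors through `G`
because `H` is abelian: it is the retraction.
-/

/-! ### Finitely supported functions on the integers -/

/-- An element of `M` is a value of every iterate of `D b k = b (k - 1) - b k`, and `D` is adjoint to
the forward difference; so `a` is orthogonal to every polynomial function on `ℤ`, which forces a
finitely supported function on `ℤ` to vanish. -/
theorem eq_zero_of_forall_eq_shift_sub {M : Set (ℤ →₀ ℤ)}
    (hM : ∀ a ∈ M, ∃ b ∈ M, ∀ k, a k = b (k - 1) - b k) {a : ℤ →₀ ℤ} (ha : a ∈ M) : a = 0 := by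
  have key : ∀ (n : ℕ) (P : ℤ → ℤ), (fwdDiff (1 : ℤ))^[n] P = 0 → ∀ a ∈ M,
      ∑ᶠ k, a k * P k = 0 := by
    intro n
    induction n with
    | zero => intro P hP a _; simp_all
    | succ n ih =>
      intro P hP a ha
      obtain ⟨b, hb, hab⟩ := hM a ha
      have hfin : ∀ R : ℤ → ℤ, (Function.support fun k => b k * R k).Finite := fun R =>
        b.hasFiniteSupport.subset fun k hk => by
          simp only [Function.mem_support] at hk ⊢
          exact left_ne_zero_of_mul hk
      have hfin' : (Function.support fun k => b (k - 1) * P k).Finite :=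
        (b.hasFiniteSupport.image (· + 1)).subset fun k hk => by
          simp only [Function.mem_support] at hk
          exact ⟨k - 1, left_ne_zero_of_mul hk, by simp⟩
      have hshift : ∑ᶠ k, b (k - 1) * P k = ∑ᶠ k, b k * P (k + 1) := by
        rw [← finsum_comp_equiv (Equiv.addRight (1 : ℤ))]
        simp
      calc ∑ᶠ k, a k * P k = ∑ᶠ k, (b (k - 1) * P k - b k * P k) := by simp only [hab, sub_mul]
        _ = ∑ᶠ k, b k * P (k + 1) - ∑ᶠ k, b k * P k := by
          rw [finsum_sub_distrib hfin' (hfin P), hshift]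
        _ = ∑ᶠ k, b k * fwdDiff 1 P k := by
          rw [← finsum_sub_distrib (hfin fun k => P (k + 1)) (hfin P)]
          simp only [fwdDiff, mul_sub]
        _ = 0 := ih _ (by rwa [Function.iterate_succ_apply] at hP) b hb
  ext k
  -- a polynomial vanishing on the support of `a` except at `k`
  let P : Polynomial ℤ := ∏ j ∈ a.support.erase k, (Polynomial.X - Polynomial.C j)
  have hP : ∀ j, P.eval j = ∏ i ∈ a.support.erase k, (j - i) := fun j => by
    simp [P, Polynomial.eval_prod]
  have h0 := key (P.natDegree + 1) (fun j => P.eval j)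
    (Polynomial.fwdDiff_iter_degree_add_one_eq_zero P) a ha
  rw [finsum_eq_single _ k] at h0
  · refine (mul_eq_zero.1 h0).resolve_right ?_
    rw [hP]
    refine Finset.prod_ne_zero_iff.2 ?_
    intro i hi
    exact sub_ne_zero.2 (Finset.ne_of_mem_erase hi).symm
  · intro j hj
    by_cases hja : a j = 0
    · simp [hja]
    · rw [hP, Finset.prod_eq_zero (i := j) (by simp [hj, hja]) (sub_self j), mul_zero]

/-! ### Path chains in Cayley graphs of quotients of a free group -/

section EdgeChains

open scoped commutatorElement

variable {X : Type*} (N : Subgroup (FreeGroup X))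

/-- Finitely supported integral 1-chains on the Cayley graph of `FreeGroup X ⧸ N`: the pair `(q, x)`
is the edge from `q` to `q * x`. -/
abbrev EdgeChains : Type _ := (FreeGroup X ⧸ N) × X →₀ ℤ

/-- Left translation of 1-chains: `g` carries the edge `(q, x)` to `(g • q, x)`. -/
noncomputable def edgeShift (g : FreeGroup X) : EdgeChains N ≃+ EdgeChains N :=
  Finsupp.domCongr ((MulAction.toPerm g).prodCongr (Equiv.refl X))

variable {N}

@[simp]
theorem edgeShift_apply (g : FreeGroup X) (a : EdgeChains N) (q : FreeGroup X ⧸ N) (x : X) :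
    edgeShift N g a (q, x) = a (g⁻¹ • q, x) := rfl

@[simp]
theorem edgeShift_single (g : FreeGroup X) (q : FreeGroup X ⧸ N) (x : X) (n : ℤ) :
    edgeShift N g (Finsupp.single (q, x) n) = Finsupp.single (g • q, x) n := by
  simp [edgeShift, Finsupp.domCongr_apply]

@[simp]
theorem edgeShift_one (a : EdgeChains N) : edgeShift N 1 a = a := by
  ext ⟨q, x⟩
  simp

theorem edgeShift_mul (g h : FreeGroup X) (a : EdgeChains N) :
    edgeShift N (g * h) a = edgeShift N g (edgeShift N h a) := by
  ext ⟨q, x⟩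
  simp [mul_smul]

theorem edgeShift_of_mem [N.Normal] {g : FreeGroup X} (hg : g ∈ N) (a : EdgeChains N) :
    edgeShift N g a = a := by
  ext ⟨q, x⟩
  induction q using QuotientGroup.induction_on with | _ q
  rw [edgeShift_apply, MulAction.Quotient.smul_coe]
  congr 2
  rw [eq_comm, QuotientGroup.eq, smul_eq_mul, ← mul_assoc]
  simpa using Subgroup.Normal.conj_mem ‹_› _ (N.inv_mem hg) q⁻¹

variable (N)

/-- `edgeShift` as an action on the multiplicative copy of the 1-chains, the form in which it enters
a semidirect product. -/
noncomputable def edgeShiftHom : FreeGroup X →* MulAut (Multiplicative (EdgeChains N)) where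
  toFun g := AddEquiv.toMultiplicative (edgeShift N g)
  map_one' := by
    ext a : 1
    exact congrArg Multiplicative.ofAdd (edgeShift_one a.toAdd)
  map_mul' g h := by
    ext a : 1
    exact congrArg Multiplicative.ofAdd (edgeShift_mul g h a.toAdd)

/-- The homomorphism `w ↦ (pathChain w, w)`, determined by its values on the generators. -/
noncomputable def pathChainHom :
    FreeGroup X →* Multiplicative (EdgeChains N) ⋊[edgeShiftHom N] FreeGroup X :=
  FreeGroup.lift fun x =>
    ⟨Multiplicative.ofAdd (Finsupp.single (((1 : FreeGroup X) : FreeGroup X ⧸ N), x) 1),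
      FreeGroup.of x⟩

/-- The 1-chain of the path that starts at the base point of the Cayley graph of `FreeGroup X ⧸ N`
and is labelled by the word `w`; in coordinates, the Fox derivatives of `w` modulo `N`. -/
noncomputable def pathChain (w : FreeGroup X) : EdgeChains N := (pathChainHom N w).left.toAdd

theorem pathChainHom_right (w : FreeGroup X) : (pathChainHom N w).right = w := by
  have : SemidirectProduct.rightHom.comp (pathChainHom N) = MonoidHom.id _ :=
    FreeGroup.ext_hom _ _ fun x => by simp [pathChainHom]
  exact DFunLike.congr_fun this w

variable {N}

theorem pathChain_of (x : X) :
    pathChain N (FreeGroup.of x) = Finsupp.single (((1 : FreeGroup X) : FreeGroup X ⧸ N), x) 1 := by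
  simp [pathChain, pathChainHom]

@[simp]
theorem pathChain_one : pathChain N 1 = 0 := by
  simp [pathChain]

/-- `pathChain` is a crossed homomorphism: the path of `v * w` is that of `v` followed by the
translate by `v` of that of `w`. -/
theorem pathChain_mul (v w : FreeGroup X) :
    pathChain N (v * w) = pathChain N v + edgeShift N v (pathChain N w) := by
  simp only [pathChain, map_mul, SemidirectProduct.mul_left, pathChainHom_right, toAdd_mul]
  rfl

theorem pathChain_inv (w : FreeGroup X) :
    pathChain N w⁻¹ = -edgeShift N w⁻¹ (pathChain N w) := by
  rw [eq_neg_iff_add_eq_zero, ← pathChain_mul, inv_mul_cancel, pathChain_one]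

/-- Rewriting along a transversal `s` recovers a word from the chain of its path: sending the edge
`(q, x)` to the class of `s(q) x s(q x)⁻¹` in the abelianization of `N` defines a homomorphism on
1-chains which maps the chain of the path labelled `w` from `g` to the class of
`s(g) w s(g w)⁻¹`. -/
theorem mem_commutator_of_pathChain_eq_zero [N.Normal] {w : FreeGroup X} (hw : w ∈ N)
    (h0 : pathChain N w = 0) : w ∈ ⁅N, N⁆ := by
  let s : FreeGroup X → FreeGroup X := fun g => (g : FreeGroup X ⧸ N).out
  have hs : ∀ g, (s g : FreeGroup X ⧸ N) = g := fun g => Quotient.out_eq _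
  have hsN : ∀ g v, s g * v * (s (g * v))⁻¹ ∈ N := fun g v => by
    rw [← QuotientGroup.eq_one_iff]
    simp [hs]
  let Ψ : FreeGroup X → FreeGroup X → Additive (Abelianization N) := fun g v =>
    Additive.ofMul (Abelianization.of ⟨s g * v * (s (g * v))⁻¹, hsN g v⟩)
  have hΨmul : ∀ g v v', Ψ g (v * v') = Ψ g v + Ψ (g * v) v' := fun g v v' => by
    simp only [Ψ, ← ofMul_mul, ← map_mul]
    congr 3
    simp [mul_assoc]
  have hΨ : ∀ g g' : FreeGroup X, (g : FreeGroup X ⧸ N) = g' → ∀ v, Ψ g v = Ψ g' v := by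
    intro g g' h v
    have h1 : s g = s g' := by simp only [s, h]
    have h2 : s (g * v) = s (g' * v) := by simp only [s, QuotientGroup.mk_mul, h]
    simp only [Ψ, h1, h2]
  -- the coefficients `Ψ` depend on `g` only modulo `N`, so a representative of the vertex will do
  let Φ : EdgeChains N →+ Additive (Abelianization N) :=
    Finsupp.liftAddHom fun e => (zmultiplesHom _) (Ψ e.1.out (FreeGroup.of e.2))
  have key : ∀ v g, Φ (edgeShift N g (pathChain N v)) = Ψ g v := by
    intro v
    have hone : ∀ g, Ψ g 1 = 0 := fun g => by
      have := hΨmul g 1 1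
      simpa using this
    induction v using FreeGroup.induction_on with
    | C1 => intro g; simp [hone]
    | of x =>
      intro g
      rw [pathChain_of, edgeShift_single]
      simp only [Φ, Finsupp.liftAddHom_apply_single, zmultiplesHom_apply, one_smul]
      exact hΨ _ _ (by
        rw [QuotientGroup.out_eq', MulAction.Quotient.smul_coe, smul_eq_mul, mul_one]) _
    | inv_of x ih =>
      intro g
      rw [pathChain_inv, map_neg, map_neg, ← edgeShift_mul, ih, neg_eq_iff_add_eq_zero]
      have := hΨmul g (FreeGroup.of x)⁻¹ (FreeGroup.of x)
      rw [inv_mul_cancel, hone] at this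
      rw [add_comm, ← this]
    | mul v v' ih ih' =>
      intro g
      rw [pathChain_mul, map_add, map_add, ← edgeShift_mul, ih, ih', hΨmul]
  have h1 := key w 1
  rw [h0, map_zero, map_zero, eq_comm, ofMul_eq_zero, ← MonoidHom.mem_ker,
    Abelianization.ker_of] at h1
  have h2 := Subgroup.mem_map_of_mem N.subtype h1
  rw [Subgroup.map_subtype_commutator] at h2
  have hs1 : s w = s 1 := by
    simp only [s, (QuotientGroup.eq_one_iff w).2 hw, QuotientGroup.mk_one]
  simpa [hs1, mul_assoc] using Subgroup.Normal.conj_mem inferInstance _ h2 (s 1)⁻¹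

/-- On each orbit of `h` the chains are finitely supported functions on `ℤ`, translated by `h`. -/
theorem eq_zero_of_forall_eq_edgeShift_sub [N.Normal] {h : FreeGroup X}
    (hinf : ∀ n : ℤ, h ^ n ∈ N → n = 0) {M : Set (EdgeChains N)}
    (hM : ∀ a ∈ M, ∃ b ∈ M, a = edgeShift N h b - b) {a : EdgeChains N} (ha : a ∈ M) : a = 0 := by
  ext ⟨q, x⟩
  have hinj : Function.Injective fun k : ℤ => (h ^ k • q, x) := by
    intro j k hjk
    induction q using QuotientGroup.induction_on with | _ g
    simp only [Prod.mk.injEq, and_true, MulAction.Quotient.smul_coe, smul_eq_mul,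
      QuotientGroup.eq] at hjk
    have := Subgroup.Normal.conj_mem ‹_› _ hjk g
    have := hinf (-j + k) (by simpa [zpow_add, mul_assoc] using this)
    lia
  let ρ : EdgeChains N → ℤ →₀ ℤ := fun b => Finsupp.comapDomain _ b hinj.injOn
  have := eq_zero_of_forall_eq_shift_sub (M := ρ '' M) (by
    rintro _ ⟨a, ha, rfl⟩
    obtain ⟨b, hb, rfl⟩ := hM a ha
    refine ⟨_, ⟨b, hb, rfl⟩, fun k => ?_⟩
    change b (h⁻¹ • h ^ k • q, x) - b (h ^ k • q, x) = b (h ^ (k - 1) • q, x) - b (h ^ k • q, x)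
    rw [smul_smul, ← zpow_neg_one, ← zpow_add, neg_add_eq_sub]) ⟨a, ha, rfl⟩
  simpa [ρ] using DFunLike.congr_fun this 0

theorem pathChain_eq_zero_of_mem_commutator [N.Normal] {z : FreeGroup X} (hz : z ∈ ⁅N, N⁆) :
    pathChain N z = 0 := by
  let f : N →* Multiplicative (EdgeChains N) :=
    { toFun := fun c => Multiplicative.ofAdd (pathChain N c)
      map_one' := by simp
      map_mul' := fun c c' => by simp [pathChain_mul, edgeShift_of_mem c.2] }
  rw [← Subgroup.map_subtype_commutator] at hz
  obtain ⟨c, hc, rfl⟩ := hz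
  exact Abelianization.commutator_subset_ker f hc

theorem pathChain_inv_of_mem [N.Normal] {c : FreeGroup X} (hc : c ∈ N) :
    pathChain N c⁻¹ = -pathChain N c := by
  rw [pathChain_inv, edgeShift_of_mem (N.inv_mem hc)]

theorem pathChain_mul_of_mem [N.Normal] {c : FreeGroup X} (hc : c ∈ N) (w : FreeGroup X) :
    pathChain N (c * w) = pathChain N c + pathChain N w := by
  rw [pathChain_mul, edgeShift_of_mem hc]

theorem pathChain_conj [N.Normal] (g : FreeGroup X) {c : FreeGroup X} (hc : c ∈ N) :
    pathChain N (g * c * g⁻¹) = edgeShift N g (pathChain N c) := by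
  rw [pathChain_mul, pathChain_mul, pathChain_inv, map_neg, ← edgeShift_mul,
    edgeShift_of_mem (Subgroup.Normal.conj_mem ‹_› c hc g)]
  abel

theorem pathChain_commutatorElement [N.Normal] {x y : FreeGroup X} (h : ⁅x, y⁆ ∈ N) :
    pathChain N ⁅x, y⁆ = edgeShift N x (pathChain N y) - pathChain N y -
      (edgeShift N y (pathChain N x) - pathChain N x) := by
  have h1 : ⁅x, y⁆ * (y * x) = x * y := by simp [commutatorElement_def, mul_assoc]
  have h2 := congrArg (pathChain N) h1
  rw [pathChain_mul_of_mem h, pathChain_mul, pathChain_mul, ← eq_sub_iff_add_eq] at h2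
  rw [h2]
  abel

/-! ### Subgroups that are cyclic modulo their commutators -/

/-- The chains of the elements of `⁅K, K⁆` form a group `M` stable under `h`. Modulo `⁅N, N⁆` the
elements of `K` are products of a power of `h` and an element of `⁅K, K⁆`, so that the chain of each
commutator lies in `(h - 1) M`. Hence `M ≤ (h - 1) M`, and `M` vanishes. -/
theorem commutator_le_commutator_of_zpow_generated [N.Normal] {K : Subgroup (FreeGroup X)}
    {h : FreeGroup X} (hK : h ∈ K) (hinf : ∀ n : ℤ, h ^ n ∈ N → n = 0) (hKN : ⁅K, K⁆ ≤ N)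
    (hgen : ∀ g ∈ K, ∃ n : ℤ, ∃ c ∈ ⁅K, K⁆, ∃ z ∈ ⁅N, N⁆, g = h ^ n * c * z) :
    ⁅K, K⁆ ≤ ⁅N, N⁆ := by
  have hKK : ∀ {g c}, g ∈ K → c ∈ ⁅K, K⁆ → g * c * g⁻¹ ∈ ⁅K, K⁆ := fun {g c} hg hc => by
    have hcK : c ∈ K := Subgroup.commutator_le_self K hc
    rw [← inv_mul_cancel_right (g * c * g⁻¹) c]
    exact mul_mem (Subgroup.commutator_mem_commutator hg hcK) hc
  let M : AddSubgroup (EdgeChains N) :=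
    { carrier := pathChain N '' (⁅K, K⁆ : Subgroup (FreeGroup X))
      zero_mem' := ⟨1, one_mem _, pathChain_one⟩
      add_mem' := by
        rintro _ _ ⟨c, hc, rfl⟩ ⟨c', hc', rfl⟩
        exact ⟨c * c', mul_mem hc hc', pathChain_mul_of_mem (hKN hc) c'⟩
      neg_mem' := by
        rintro _ ⟨c, hc, rfl⟩
        exact ⟨c⁻¹, inv_mem hc, pathChain_inv_of_mem (hKN hc)⟩ }
  have hMstab : ∀ (n : ℤ), ∀ m ∈ M, edgeShift N (h ^ n) m ∈ M := by
    rintro n _ ⟨c, hc, rfl⟩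
    exact ⟨_, hKK (K.zpow_mem hK n) hc, pathChain_conj _ (hKN hc)⟩
  let D : EdgeChains N →+ EdgeChains N := (edgeShift N h).toAddMonoidHom - AddMonoidHom.id _
  have hD : ∀ m, D m = edgeShift N h m - m := fun _ => rfl
  have hDpow : ∀ (n : ℤ), ∀ m ∈ M, edgeShift N (h ^ n) m - m ∈ M.map D := by
    intro n
    induction n using Int.induction_on with
    | zero => intro m _; simp
    | succ n ih =>
      intro m hm
      have h1 : edgeShift N h m ∈ M := by simpa using hMstab 1 m hm
      have := add_mem (ih _ h1) (AddSubgroup.mem_map_of_mem D hm)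
      rwa [hD, ← edgeShift_mul, ← zpow_add_one, sub_add_sub_cancel] at this
    | pred n ih =>
      intro m hm
      have h1 : edgeShift N h⁻¹ m ∈ M := by simpa using hMstab (-1) m hm
      have := sub_mem (ih _ h1) (AddSubgroup.mem_map_of_mem D h1)
      rwa [hD, ← edgeShift_mul, ← edgeShift_mul, ← zpow_sub_one, mul_inv_cancel, edgeShift_one,
        ← sub_add, sub_right_comm, sub_add_cancel] at this
  have hdecomp : ∀ x ∈ K, ∃ n : ℤ, ∃ m ∈ M, pathChain N x = pathChain N (h ^ n) + m ∧
      ∀ a, edgeShift N x a = edgeShift N (h ^ n) a := by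
    intro x hx
    obtain ⟨n, c, hc, z, hz, rfl⟩ := hgen x hx
    have hzN : z ∈ N := Subgroup.commutator_le_self N hz
    refine ⟨n, _, hMstab n _ ⟨c, hc, rfl⟩, ?_, fun a => ?_⟩
    · rw [mul_assoc, pathChain_mul, pathChain_mul, pathChain_eq_zero_of_mem_commutator hz,
        map_zero, add_zero]
    · rw [mul_assoc, edgeShift_mul, edgeShift_of_mem (mul_mem (hKN hc) hzN)]
  -- the commutator of two powers of `h` is trivial
  have hcomm : ∀ a b : ℤ, edgeShift N (h ^ a) (pathChain N (h ^ b)) - pathChain N (h ^ b) =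
      edgeShift N (h ^ b) (pathChain N (h ^ a)) - pathChain N (h ^ a) := by
    intro a b
    have : pathChain N (h ^ a * h ^ b) = pathChain N (h ^ b * h ^ a) := by
      rw [← zpow_add, ← zpow_add, add_comm]
    rw [pathChain_mul, pathChain_mul] at this
    rw [sub_eq_sub_iff_add_eq_add, add_comm, this, add_comm]
  let S : Subgroup (FreeGroup X) :=
    { carrier := {c | c ∈ N ∧ pathChain N c ∈ M.map D}
      one_mem' := ⟨one_mem _, by simp⟩
      mul_mem' := fun {c c'} hc hc' => ⟨mul_mem hc.1 hc'.1, by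
        rw [pathChain_mul_of_mem hc.1]
        exact add_mem hc.2 hc'.2⟩
      inv_mem' := fun {c} hc => ⟨inv_mem hc.1, by
        rw [pathChain_inv_of_mem hc.1]
        exact neg_mem hc.2⟩ }
  have hS : ⁅K, K⁆ ≤ S := by
    rw [Subgroup.commutator_le]
    intro x hx y hy
    have hxy := hKN (Subgroup.commutator_mem_commutator hx hy)
    refine ⟨hxy, ?_⟩
    obtain ⟨a, m, hm, hxm, hxa⟩ := hdecomp x hx
    obtain ⟨b, m', hm', hym, hyb⟩ := hdecomp y hy
    have := sub_mem (hDpow a m' hm') (hDpow b m hm)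
    convert this using 1
    rw [pathChain_commutatorElement hxy, hxa, hyb, hxm, hym, map_add, map_add, add_sub_add_comm,
      add_sub_add_comm, hcomm a b, add_sub_add_left_eq_sub]
  intro c hc
  refine mem_commutator_of_pathChain_eq_zero (hKN hc)
    (eq_zero_of_forall_eq_edgeShift_sub hinf (M := M) ?_ ⟨c, hc, rfl⟩)
  rintro _ ⟨c, hc, rfl⟩
  obtain ⟨m, hm, hmc⟩ := (hS hc).2
  exact ⟨m, hm, hmc.symm⟩

/-- The abelianization of a free group is torsion free. -/
theorem eq_zero_of_zpow_mem_commutator {h : FreeGroup X} (hh : h ∉ commutator (FreeGroup X)) {n : ℤ}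
    (hn : h ^ n ∈ commutator (FreeGroup X)) : n = 0 := by
  rw [← Abelianization.ker_of, MonoidHom.mem_ker] at hh hn
  let e : Additive (Abelianization (FreeGroup X)) ≃+ (X →₀ ℤ) := FreeAbelianGroup.equivFinsupp X
  have h1 : n • e (Additive.ofMul (Abelianization.of h)) = 0 := by
    rw [← map_zsmul, ← ofMul_zpow, ← map_zpow, hn, ofMul_one, map_zero]
  refine (smul_eq_zero.1 h1).resolve_right fun h2 => hh ?_
  simpa using h2

end EdgeChains

/-! ### Verbally closed subgroups of free solvable groups -/

/-- The equation `w = w`, whose left-hand side is read as a word in the generators and whose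
right-hand side is the element it represents, has the generators as a solution. -/
theorem IsVerballyClosed.exists_hom {r d : ℕ} {H : Subgroup (FreeSolvableGroup r d)}
    (hvc : IsVerballyClosed H) {w : FreeGroup (Fin r)} (hw : (w : FreeSolvableGroup r d) ∈ H) :
    ∃ φ : FreeGroup (Fin r) →* H, (φ w : FreeSolvableGroup r d) = w := by
  obtain ⟨g, hgH, hg⟩ := hvc r w w hw ⟨fun i => (FreeGroup.of i : FreeGroup (Fin r)), by
    have : FreeGroup.lift (fun i => ((FreeGroup.of i : FreeGroup (Fin r)) : FreeSolvableGroup r d)) =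
        QuotientGroup.mk' _ := FreeGroup.ext_hom _ _ fun i => by simp
    rw [this, QuotientGroup.mk'_apply]⟩
  refine ⟨FreeGroup.lift fun i => ⟨g i, hgH i⟩, ?_⟩
  have : H.subtype.comp (FreeGroup.lift fun i => ⟨g i, hgH i⟩) = FreeGroup.lift g :=
    FreeGroup.ext_hom _ _ fun i => by simp
  rw [← hg, ← this]
  rfl

theorem exists_generator_of_abRank_eq_one {G : Type*} [Group G] {H : Subgroup G} [Group.FG H]
    (hrank : abRank H = 1) : ∃ h ∈ H, Abelianization.of h ≠ 1 ∧
      ∀ x ∈ H, ∃ n : ℤ, Abelianization.of x = Abelianization.of h ^ n := by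
  have : Group.FG (H.map (Abelianization.of (G := G))) :=
    Group.fg_of_surjective (Abelianization.of.subgroupMap_surjective H)
  have hrank' : Group.rank (H.map (Abelianization.of (G := G))) = 1 := hrank
  obtain ⟨S, hS, hcl⟩ := Group.rank_spec (H.map (Abelianization.of (G := G)))
  rw [hrank', Finset.card_eq_one] at hS
  obtain ⟨⟨_, h, hh, rfl⟩, rfl⟩ := hS
  refine ⟨h, hh, fun h1 => ?_, fun x hx => ?_⟩
  · have := Group.rank_le (G := H.map (Abelianization.of (G := G))) (S := ∅) (by
      rw [← hcl, Finset.coe_singleton, Finset.coe_empty, Subgroup.closure_empty, eq_comm,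
        Subgroup.closure_eq_bot_iff]
      exact Set.singleton_subset_singleton.2 (Subtype.ext h1))
    simp [hrank'] at this
  · have hx' : (⟨_, x, hx, rfl⟩ : H.map (Abelianization.of (G := G))) ∈
        (⊤ : Subgroup (H.map (Abelianization.of (G := G)))) := trivial
    rw [← hcl, Finset.coe_singleton, Subgroup.mem_closure_singleton] at hx'
    obtain ⟨n, hn⟩ := hx'
    exact ⟨n, (congrArg Subtype.val hn).symm⟩

theorem theorem1 (r d : ℕ) (H : Subgroup (FreeSolvableGroup r d)) [Group.FG H]
    (hvc : IsVerballyClosed H) (hrank : abRank H = 1) : IsRetractOf H := by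
  obtain _ | d := d
  · -- in class `0` the group is trivial, and `derivedSeries _ 0` is not below the commutator subgroup
    have : Subsingleton (FreeSolvableGroup r 0) :=
      QuotientGroup.subsingleton_quotient_top
    exact ⟨1, fun _ => Subsingleton.elim _ _⟩
  let π := QuotientGroup.mk' (derivedSeries (FreeGroup (Fin r)) (d + 1))
  have hπ : Function.Surjective π := QuotientGroup.mk'_surjective _
  have hker : π.ker = derivedSeries (FreeGroup (Fin r)) (d + 1) := QuotientGroup.ker_mk' _
  have hle : derivedSeries (FreeGroup (Fin r)) (d + 1) ≤ commutator _ := by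
    rw [← derivedSeries_one]
    exact derivedSeries_antitone _ (by lia)
  obtain ⟨h', hh', hne, hcyc⟩ := exists_generator_of_abRank_eq_one hrank
  obtain ⟨h, rfl⟩ := hπ h'
  have hmem : ∀ w, Abelianization.of (π w) = 1 ↔ w ∈ commutator (FreeGroup (Fin r)) := by
    intro w
    rw [← MonoidHom.mem_ker, Abelianization.ker_of, commutator_def, ← MonoidHom.range_eq_top.2 hπ,
      MonoidHom.range_eq_map, ← Subgroup.map_commutator, ← Subgroup.mem_comap,
      Subgroup.comap_map_eq, hker, ← commutator_def, sup_eq_left.2 hle]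
  let K := H.comap π
  have hKH : ⁅K, K⁆.map π = ⁅H, H⁆ := by
    rw [Subgroup.map_commutator, Subgroup.map_comap_eq_self_of_surjective hπ]
  have hHH : ∀ c ∈ commutator H, (c : FreeSolvableGroup r (d + 1)) ∈ ⁅H, H⁆ := fun c hc => by
    rw [← Subgroup.map_subtype_commutator]
    exact Subgroup.mem_map_of_mem _ hc
  have hφ : ∀ (φ : FreeGroup (Fin r) →* H), ∀ w ∈ commutator (FreeGroup (Fin r)),
      φ w ∈ commutator H := fun φ w hw =>
    Subgroup.commutator_mono le_top le_top
      (Subgroup.map_commutator ⊤ ⊤ φ ▸ Subgroup.mem_map_of_mem φ hw)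
  have hgen : ∀ g ∈ K, ∃ n : ℤ, ∃ c ∈ ⁅K, K⁆, ∃ z ∈ derivedSeries (FreeGroup (Fin r)) (d + 1),
      g = h ^ n * c * z := by
    intro g hg
    obtain ⟨n, hn⟩ := hcyc _ hg
    -- `H ∩ G' = H'`, applied to the part of `g` in the commutator subgroup
    have hu : h ^ (-n) * g ∈ commutator (FreeGroup (Fin r)) := by
      rw [← hmem, map_mul, map_mul, hn, map_zpow, map_zpow, zpow_neg, inv_mul_cancel]
    obtain ⟨φ, hφu⟩ := hvc.exists_hom (w := h ^ (-n) * g) (mul_mem (K.zpow_mem hh' _) hg : _ ∈ K)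
    have hu' := hHH _ (hφ φ _ hu)
    rw [hφu, ← hKH] at hu'
    obtain ⟨c, hc, hcu⟩ := hu'
    refine ⟨n, c, hc, c⁻¹ * (h ^ (-n) * g), QuotientGroup.eq.1 hcu, ?_⟩
    simp [mul_assoc]
  have hinf : ∀ n : ℤ, h ^ n ∈ commutator (FreeGroup (Fin r)) → n = 0 := fun n =>
    eq_zero_of_zpow_mem_commutator (mt (hmem h).2 hne)
  have hK : ∀ k ≤ d, ⁅K, K⁆ ≤ derivedSeries (FreeGroup (Fin r)) (k + 1) := by
    intro k hk
    induction k with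
    | zero => exact Subgroup.commutator_mono le_top le_top
    | succ k ih =>
      refine commutator_le_commutator_of_zpow_generated hh' (fun n hn => hinf n ?_) (ih (by lia))
        fun g hg => ?_
      · rw [← derivedSeries_one]
        exact derivedSeries_antitone _ (by lia) hn
      · obtain ⟨n, c, hc, z, hz, rfl⟩ := hgen g hg
        exact ⟨n, c, hc, z, derivedSeries_antitone _ (show k + 1 + 1 ≤ d + 1 by lia) hz, rfl⟩
  have hH1 : ∀ c ∈ commutator H, c = 1 := fun c hc => by
    obtain ⟨b, hb, hbc⟩ := hKH ▸ hHH c hc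
    exact Subtype.ext (hbc.symm.trans ((QuotientGroup.eq_one_iff b).2 (hK d le_rfl hb)))
  -- `H` is now generated by the image of `h`
  obtain ⟨φ, hφh⟩ := hvc.exists_hom hh'
  refine ⟨QuotientGroup.lift _ φ fun w hw => hH1 _ (hφ φ w (hle hw)), ?_⟩
  rintro ⟨x, hx⟩
  obtain ⟨g, rfl⟩ := hπ x
  obtain ⟨n, c, hc, z, hz, rfl⟩ := hgen g hx
  have hg : π (h ^ n * c * z) = π h ^ n := by
    have hz1 : π z = 1 := (QuotientGroup.eq_one_iff z).2 hz
    have hc1 : π c = 1 := (QuotientGroup.eq_one_iff c).2 (hK d le_rfl hc)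
    rw [map_mul, map_mul, hz1, hc1, mul_one, mul_one, map_zpow]
  apply Subtype.ext
  simp only [hg, map_zpow]
  rw [Subgroup.coe_zpow]
  exact congrArg (· ^ n) hφh
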